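/- Let $(\Omega,\Sigma,\mu)$ be a $\sigma$-finite measure space, $\mathbb{F}\in\{\mathbb{R},\mathbb{C}\}$, and let $P\colon\Omega\to(0,\infty]$ be measurable. For $p\in(0,\infty)$ put $\Phi_p(t)=t^p$, and put $\Phi_\infty(t)=0$ for $0\le t\le 1$, $\Phi_\infty(t)=\infty$ for $t>1$. Put $\rho_P(f)=\int_\Omega \Phi_{P(\omega)}(|f(\omega)|)\,d\mu(\omega)$, let $L_P$ be the space of all measurable $f\colon\Omega\to\mathbb{F}$ (modulo a.e. equality) with $\rho_P(tf)<\infty$ for some $t>0$, endowed with the vector topology having the sets $u\{f\colon\rho_P(f)<\varepsilon\}$, $u,\varepsilon\in(0,\infty)$, as a neighbourhood basis of the origin, and put $\|f\|_P=\inf\{t>0\colon\rho_P(f/t)<1\}$. Let $R(P)\subseteq[0,\infty]$ be the essential range of $P$, that is, the support of the image measure of $\mu$ under $P$, and assume that $P^-:=\min R(P)>0$. An Orlicz function is a non-decreasing left-continuous function $F\colon[0,\infty)\to[0,\infty]$ with $\lim_{t\to0^+}F(t)=0$ and $\lim_{t\to\infty}F(t)>0$. Its Orlicz sequence space $\ell_F$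 consists of all $a=(a_n)_{n=1}^\infty\in\mathbb{F}^{\mathbb{N}}$ with $\sum_n F(t|a_n|)<\infty$ for some $t>0$, with the vector topology having the sets $u\{a\colon\sum_nF(|a_n|)<\varepsilon\}$, $u,\varepsilon\in(0,\infty)$, as a neighbourhood basis of the origin. For $\emptyset\ne R\subseteq(0,\infty]$ let $\mathcal{K}(R)$ be the closed convex hull in $\mathcal{C}([0,1])$ of the functions $\psi_p(t)=t^p/p$, $p\in R$ (where $\psi_\infty=0$), and let $\mathcal{O}(R)$ be the set of all Orlicz functions $F$ for which there are $c\in(0,1]$, $C\in(0,\infty)$ and $\varphi\in\mathcal{K}(R)$ with $C^{-1}\varphi(t)\le F(t)\le C\varphi(t)$ for all $t\in[0,c]$. Let $(x_n)_{n=1}^\infty$ be a sequence in $L_P$ that is pairwise disjointly supported (up to null sets) and semi-normalized, i.e., there are $a,b\in(0,\infty)$ with $a\le\|x_n\|_P\le b$ for all $n$. Then $(x_n)$ has a subsequence $\mathcal{Y}=(y_n)_{n=1}^\infty$ and there is $F\in\mathcal{O}(R(P))$ such that the coefficient space \[ \mathbb{S}[L_P,\mathcal{Y}]=\Bigl\{(a_n)_{n=1}^\infty\in\mathbb{F}^{\mathbb{N}}\colon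 \sum_{n=1}^\infty a_ny_n\in L_P\Bigr\} \] (with the pointwise a.e. sum), endowed with the topology it inherits from $L_P$ through $(a_n)\mapsto\sum_n a_ny_n$, coincides with $\ell_F$, both as a set and as a topological space. -/

import Mathlib

open MeasureTheory Filter Topology
open scoped NNReal ENNReal

noncomputable section

namespace VarLeb

/-! ### Musielak-Orlicz spaces -/

/-- An Orlicz function: a non-decreasing, left-continuous `F : [0,∞) → [0,∞]` with
`F(t) → 0` as `t → 0⁺` and `lim_{t → ∞} F(t) > 0`. -/
structure IsOrlicz (F : ℝ≥0 → ℝ≥0∞) : Prop where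
  monotone : Monotone F
  left_cont : ∀ t, ContinuousWithinAt F (Set.Iio t) t
  tendsto_zero : Tendsto F (𝓝[>] 0) (𝓝 0)
  exists_pos : ∃ t, 0 < F t

section Spaces

variable {Ω : Type*} [MeasurableSpace Ω] {𝕜 : Type*} [RCLike 𝕜]

/-- The modular `ρ_M(f) = ∫ M(ω, f(ω)) dμ(ω)` of a function `f ≥ 0`. -/
def modular (M : Ω → ℝ≥0 → ℝ≥0∞) (μ : Measure Ω) (f : Ω → ℝ≥0) : ℝ≥0∞ :=
  ∫⁻ ω, M ω (f ω) ∂μ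

/-- The space `L_M`: the measurable functions `f` with `ρ_M(t|f|) < ∞` for some `t > 0`.
Functions that agree almost everywhere are not identified in the type, but nothing below
distinguishes between them. -/
def moSpace (𝕜 : Type*) [RCLike 𝕜] (M : Ω → ℝ≥0 → ℝ≥0∞) (μ : Measure Ω) : Set (Ω → 𝕜) :=
  {f | AEStronglyMeasurable f μ ∧ ∃ t : ℝ≥0, 0 < t ∧ modular M μ (fun ω => t * ‖f ω‖₊) < ∞}

/-- The vector topology of `L_M`: a neighbourhood basis of `f` is formed by the sets
`f + u B_M(ε) = {g | ρ_M(|g - f| / u) < ε}`, `u, ε ∈ (0,∞)`. -/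
def moTopology (𝕜 : Type*) [RCLike 𝕜] (M : Ω → ℝ≥0 → ℝ≥0∞) (μ : Measure Ω) :
    TopologicalSpace (moSpace 𝕜 M μ) :=
  TopologicalSpace.mkOfNhds fun f =>
    ⨅ (u : ℝ≥0) (_ : 0 < u) (ε : ℝ≥0) (_ : 0 < ε),
      𝓟 {g | modular M μ (fun ω => ‖(g : Ω → 𝕜) ω - (f : Ω → 𝕜) ω‖₊ / u) < ε}

/-- The Luxemburg functional `inf {t ∈ (0,∞) | ρ_M(|f| / t) < 1}`. -/
def luxemburg (M : Ω → ℝ≥0 → ℝ≥0∞) (μ : Measure Ω) (f : Ω → 𝕜) : ℝ≥0∞ :=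
  ⨅ (t : ℝ≥0) (_ : 0 < t) (_ : modular M μ (fun ω => ‖f ω‖₊ / t) < 1), (t : ℝ≥0∞)

/-- The sequence `x` is pairwise disjointly supported, up to null sets. -/
def DisjointlySupported (μ : Measure Ω) (x : ℕ → Ω → 𝕜) : Prop :=
  Pairwise fun m n => ∀ᵐ ω ∂μ, x m ω = 0 ∨ x n ω = 0

/-- The sequence `x` lies in `L_M` and its norms are bounded away from `0` and `∞`. -/
def SemiNormalized (M : Ω → ℝ≥0 → ℝ≥0∞) (μ : Measure Ω) (x : ℕ → Ω → 𝕜) : Prop :=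
  (∀ n, x n ∈ moSpace 𝕜 M μ) ∧
    ∃ a b : ℝ≥0, 0 < a ∧ ∀ n, (a : ℝ≥0∞) ≤ luxemburg M μ (x n) ∧ luxemburg M μ (x n) ≤ b

/-- The pointwise sum `∑ aₙ xₙ`; when `x` is disjointly supported, at almost every point at
most one term is nonzero. -/
def combine (x : ℕ → Ω → 𝕜) (a : ℕ → 𝕜) : Ω → 𝕜 :=
  fun ω => ∑' n, a n * x n ω

/-- The coefficient space `𝕊[L_M, x] = {a | ∑ aₙ xₙ ∈ L_M}`. -/
def coeffSpace (M : Ω → ℝ≥0 → ℝ≥0∞) (μ : Measure Ω) (x : ℕ → Ω → 𝕜) : Set (ℕ → 𝕜) :=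
  {a | combine x a ∈ moSpace 𝕜 M μ}

/-- The topology that `𝕊[L_M, x]` inherits from `L_M` through `a ↦ ∑ aₙ xₙ`. -/
def coeffTopology (M : Ω → ℝ≥0 → ℝ≥0∞) (μ : Measure Ω) (x : ℕ → Ω → 𝕜) :
    TopologicalSpace (coeffSpace M μ x) :=
  (moTopology 𝕜 M μ).induced fun a => ⟨combine x a.1, a.2⟩

end Spaces

/-- The Orlicz sequence space `ℓ_F`. -/
def orliczSeqSpace (𝕜 : Type*) [RCLike 𝕜] (F : ℝ≥0 → ℝ≥0∞) : Set (ℕ → 𝕜) :=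
  moSpace 𝕜 (fun _ : ℕ => F) Measure.count

/-- The topology of `ℓ_F`. -/
def orliczSeqTopology (𝕜 : Type*) [RCLike 𝕜] (F : ℝ≥0 → ℝ≥0∞) :
    TopologicalSpace (orliczSeqSpace 𝕜 F) :=
  moTopology 𝕜 (fun _ : ℕ => F) Measure.count

/-! ### Variable exponents -/

/-- The potential function `Φ_p(t) = t ^ p` for `p < ∞`, and `Φ_∞ = ∞ χ_{(1,∞)}`. -/
def potential (p : ℝ≥0∞) (t : ℝ≥0) : ℝ≥0∞ :=
  if p = ∞ then (if t ≤ 1 then 0 else ∞) else (t : ℝ≥0∞) ^ p.toReal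

section Exponent

variable {Ω : Type*} [MeasurableSpace Ω]

/-- The function `M_P(ω, t) = Φ_{P(ω)}(t)`, from which `L_P` is built. -/
def expMO (P : Ω → ℝ≥0∞) : Ω → ℝ≥0 → ℝ≥0∞ :=
  fun ω t => potential (P ω) t

/-- The essential range `R(P)`: the support of the image measure of `μ` under `P`. -/
def essRange (P : Ω → ℝ≥0∞) (μ : Measure Ω) : Set ℝ≥0∞ :=
  (μ.map P).support

end Exponent

/-! ### Orlicz functions generated near zero by power functions -/

/-- The function `ψ_p(t) = t ^ p / p` on `[0,1]`, with `ψ_∞ = 0`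
(the value at `p = 0` is irrelevant). -/
def psi (p : ℝ≥0∞) : C(unitInterval, ℝ) where
  toFun t := if p = ∞ then 0 else (t : ℝ) ^ p.toReal / p.toReal
  continuous_toFun := by
    by_cases h : p = ∞
    · simp only [h, if_true]; exact continuous_const
    · simp only [h, if_false]
      exact (continuous_subtype_val.rpow_const
        fun _ => Or.inr ENNReal.toReal_nonneg).div_const _

/-- `𝒦(R)`: the closed convex hull of `{ψ_p | p ∈ R}` in `C([0,1])`. -/
def hullK (R : Set ℝ≥0∞) : Set C(unitInterval, ℝ) :=
  closure (convexHull ℝ (psi '' R))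

/-- `𝒪(R)`: the Orlicz functions that are equivalent, on some interval `[0,c]` with
`0 < c ≤ 1`, to a function of `𝒦(R)`. -/
def orliczClass (R : Set ℝ≥0∞) : Set (ℝ≥0 → ℝ≥0∞) :=
  {F | IsOrlicz F ∧ ∃ c : ℝ, 0 < c ∧ c ≤ 1 ∧ ∃ φ ∈ hullK R, ∃ C : ℝ≥0, 0 < C ∧
    ∀ t : unitInterval, (t : ℝ) ≤ c →
      ENNReal.ofReal (φ t) ≤ C * F (Real.toNNReal t) ∧
        F (Real.toNNReal t) ≤ C * ENNReal.ofReal (φ t)}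

end VarLeb

end

noncomputable section

namespace VarLeb

/-! ### Modulars -/

/-! Fix `r > 0` below the essential range. The bounds on the norms give `0 < s ≤ t` with `ρ(s|xₙ|) ≤
1 ≤ ρ(t|xₙ|)` for all `n`. Put `g = s|xₙ|` and let `ν` be the image under `P` of the measure with
density `P · Φ_P(g/2)`. Since `Φ_p(τg/2) = p Φ_p(g/2) ψ_p(τ)`, the function `τ ↦ ρ(τg/2)` on `[0,1]`
is `∫ ψ_p(τ) dν(p)`, and `p ≤ 2^p` gives `ν` mass at most `1`. If `∞ ∈ R(P)`, the missing mass is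
placed at `∞`, where `ψ_∞ = 0`; otherwise the exponents are bounded and `ρ(t|xₙ|) ≥ 1` bounds the
mass from below. Either way the function is comparable, uniformly in `n`, with some `φₙ ∈ 𝒦(R(P))`
(`exists_hullK_modular`).

The set `𝒦(R(P))` is compact (`isCompact_hullK`), so along a subsequence `φₙ` lies within `2⁻ⁿ` of a
limit `φ`. By disjointness the modular of `∑ aₙyₙ` is the sum of the modulars of the terms, so
replacing every `φₙ` by `φ` costs at most `∑ 2⁻ⁿ = 2`. Thus a half ball of either modular, suitably
dilated, is bounded for the other (`exists_extendTop_dominates`). Scaling the argument by `σ ≤ 1`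
multiplies both modulars by at most `σ^r`, which turns boundedness into smallness and identifies the
sets and the topologies. -/

/-- The regularity of `M` on which the elementary theory of `L_M` rests. -/
structure IsMusielak {Ω : Type*} [MeasurableSpace Ω] (M : Ω → ℝ≥0 → ℝ≥0∞) : Prop where
  monotone : ∀ ω, Monotone (M ω)
  map_zero : ∀ ω, M ω 0 = 0
  measurable : Measurable fun z : Ω × ℝ≥0 => M z.1 z.2

section General

variable {Ω : Type*} [MeasurableSpace Ω] {𝕜 : Type*} [RCLike 𝕜]
  {M : Ω → ℝ≥0 → ℝ≥0∞} {μ : Measure Ω}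

theorem modular_mono (hM : IsMusielak M) {f g : Ω → ℝ≥0} (h : ∀ᵐ ω ∂μ, f ω ≤ g ω) :
    modular M μ f ≤ modular M μ g :=
  lintegral_mono_ae (h.mono fun ω hω => hM.monotone ω hω)

theorem IsMusielak.aemeasurable (hM : IsMusielak M) {f : Ω → ℝ≥0} (hf : AEMeasurable f μ) :
    AEMeasurable (fun ω => M ω (f ω)) μ :=
  hM.measurable.comp_aemeasurable (aemeasurable_id.prodMk hf)

/-- Monotonicity bounds `M` at a maximum by the sum of the two values; no convexity is needed, which
allows exponents below `1`. -/
theorem modular_le_add (hM : IsMusielak M) {f g h : Ω → ℝ≥0} (hf : AEMeasurable f μ)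
    (hh : ∀ ω, h ω ≤ max (f ω) (g ω)) : modular M μ h ≤ modular M μ f + modular M μ g := by
  rw [modular, modular, modular, ← lintegral_add_left' (hM.aemeasurable hf)]
  refine lintegral_mono fun ω => (hM.monotone ω (hh ω)).trans ?_
  rcases max_choice (f ω) (g ω) with h | h <;> rw [h]
  · exact le_self_add
  · exact le_add_self

theorem mem_nhds_filter {f : moSpace 𝕜 M μ} (hM : IsMusielak M) {S : Set (moSpace 𝕜 M μ)} :
    S ∈ (⨅ (u : ℝ≥0) (_ : 0 < u) (ε : ℝ≥0) (_ : 0 < ε),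
      𝓟 {g : moSpace 𝕜 M μ | modular M μ (fun ω => ‖(g : Ω → 𝕜) ω - (f : Ω → 𝕜) ω‖₊ / u) < ε}) ↔
    ∃ u : ℝ≥0, 0 < u ∧ ∃ ε : ℝ≥0, 0 < ε ∧ ∀ g : moSpace 𝕜 M μ,
      modular M μ (fun ω => ‖(g : Ω → 𝕜) ω - (f : Ω → 𝕜) ω‖₊ / u) < ε → g ∈ S := by
  have key := hasBasis_biInf_principal
    (s := fun p : ℝ≥0 × ℝ≥0 => {g : moSpace 𝕜 M μ |
      modular M μ (fun ω => ‖(g : Ω → 𝕜) ω - (f : Ω → 𝕜) ω‖₊ / p.1) < p.2})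
    (S := Set.Ioi 0 ×ˢ Set.Ioi 0) ?_ ⟨(1, 1), by simp⟩
  · have e : (⨅ (u : ℝ≥0) (_ : 0 < u) (ε : ℝ≥0) (_ : 0 < ε), 𝓟 {g : moSpace 𝕜 M μ |
        modular M μ (fun ω => ‖(g : Ω → 𝕜) ω - (f : Ω → 𝕜) ω‖₊ / u) < ε}) =
        ⨅ p ∈ (Set.Ioi 0 ×ˢ Set.Ioi 0 : Set (ℝ≥0 × ℝ≥0)), 𝓟 {g : moSpace 𝕜 M μ |
          modular M μ (fun ω => ‖(g : Ω → 𝕜) ω - (f : Ω → 𝕜) ω‖₊ / p.1) < p.2} := by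
      simp only [iInf_prod, Set.mem_prod, Set.mem_Ioi, iInf_and]
      exact iInf_congr fun u => iInf_comm
    rw [e, key.mem_iff]
    simp only [Prod.exists, Set.mem_prod, Set.mem_Ioi, and_assoc, Set.subset_def, Set.mem_ofPred_eq,
      exists_and_left]
  · rintro ⟨u, ε⟩ ⟨hu, hε⟩ ⟨v, δ⟩ ⟨hv, hδ⟩
    simp only [Set.mem_Ioi] at hu hε hv hδ
    refine ⟨(min u v, min ε δ), by simp_all, ?_, ?_⟩
    · intro g hg
      refine (modular_mono hM (.of_forall fun ω => ?_)).trans_lt (hg.trans_le ?_)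
      · exact div_le_div_of_nonneg_left (zero_le) (lt_min hu hv) (min_le_left _ _)
      · exact_mod_cast min_le_left _ _
    · intro g hg
      refine (modular_mono hM (.of_forall fun ω => ?_)).trans_lt (hg.trans_le ?_)
      · exact div_le_div_of_nonneg_left (zero_le) (lt_min hu hv) (min_le_right _ _)
      · exact_mod_cast min_le_right _ _

/-- The neighbourhood axiom behind `mkOfNhds` holds because two steps of size `u / 2` and modular `ε
/ 2` compose to one of size `u` and modular `ε`: a sum is at most twice the maximum. -/
theorem mem_nhds_moTopology (hM : IsMusielak M) {f : moSpace 𝕜 M μ} {S : Set (moSpace 𝕜 M μ)} :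
    S ∈ @nhds _ (moTopology 𝕜 M μ) f ↔
    ∃ u : ℝ≥0, 0 < u ∧ ∃ ε : ℝ≥0, 0 < ε ∧ ∀ g : moSpace 𝕜 M μ,
      modular M μ (fun ω => ‖(g : Ω → 𝕜) ω - (f : Ω → 𝕜) ω‖₊ / u) < ε → g ∈ S := by
  rw [← mem_nhds_filter hM, moTopology, TopologicalSpace.nhds_mkOfNhds]
  · intro f S hS
    obtain ⟨u, hu, ε, hε, h⟩ := (mem_nhds_filter hM).1 hS
    refine mem_pure.2 (h f ?_)
    simpa [modular, hM.map_zero] using hε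
  · intro f S hS
    obtain ⟨u, hu, ε, hε, h⟩ := (mem_nhds_filter hM).1 hS
    refine (mem_nhds_filter hM).2 ⟨u / 2, half_pos hu, ε / 2, half_pos hε, fun g hg => ?_⟩
    refine (mem_nhds_filter hM).2 ⟨u / 2, half_pos hu, ε / 2, half_pos hε, fun k hk => h k ?_⟩
    refine (modular_le_add hM (f := fun ω => ‖(k : Ω → 𝕜) ω - (g : Ω → 𝕜) ω‖₊ / (u / 2))
      (g := fun ω => ‖(g : Ω → 𝕜) ω - (f : Ω → 𝕜) ω‖₊ / (u / 2)) ?_ fun ω => ?_).trans_lt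
      ((ENNReal.add_lt_add hk hg).trans_eq ?_)
    · exact ((k.2.1.sub g.2.1).nnnorm.aemeasurable).div_const _
    · have h1 : ‖(k : Ω → 𝕜) ω - (f : Ω → 𝕜) ω‖₊ ≤
          ‖(k : Ω → 𝕜) ω - (g : Ω → 𝕜) ω‖₊ + ‖(g : Ω → 𝕜) ω - (f : Ω → 𝕜) ω‖₊ := by
        simpa using nnnorm_add_le ((k : Ω → 𝕜) ω - (g : Ω → 𝕜) ω) ((g : Ω → 𝕜) ω - (f : Ω → 𝕜) ω)
      generalize ‖(k : Ω → 𝕜) ω - (f : Ω → 𝕜) ω‖₊ = A at *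
      generalize ‖(k : Ω → 𝕜) ω - (g : Ω → 𝕜) ω‖₊ = B at *
      generalize ‖(g : Ω → 𝕜) ω - (f : Ω → 𝕜) ω‖₊ = D at *
      rw [← (show Monotone fun x : ℝ≥0 => x / (u / 2) from fun _ _ h => by dsimp only; gcongr).map_max, div_le_div_iff₀ hu (half_pos hu)]
      have h2 : A ≤ 2 * max B D := by
        rw [two_mul]; exact h1.trans (add_le_add (le_max_left _ _) (le_max_right _ _))
      calc A * (u / 2) ≤ 2 * max B D * (u / 2) := by gcongr
        _ = max B D * u := by ring
    · rw [← ENNReal.coe_add, add_halves]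

/-! ### Disjointly supported sequences -/

variable {y : ℕ → Ω → 𝕜}

theorem DisjointlySupported.ae_forall (hy : DisjointlySupported μ y) :
    ∀ᵐ ω ∂μ, ∃ k, ∀ n, n ≠ k → y n ω = 0 := by
  have : ∀ᵐ ω ∂μ, ∀ m n, m ≠ n → y m ω = 0 ∨ y n ω = 0 := by
    rw [ae_all_iff]; intro m
    rw [ae_all_iff]; intro n
    by_cases h : m = n
    · simp [h]
    · filter_upwards [hy h] with ω hω _ using hω
  filter_upwards [this] with ω hω
  by_cases h : ∃ k, y k ω ≠ 0
  · obtain ⟨k, hk⟩ := h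
    exact ⟨k, fun n hn => (hω n k hn).resolve_right hk⟩
  · push Not at h
    exact ⟨0, fun n _ => h n⟩

theorem combine_eq_of_forall {Ω : Type*} {y : ℕ → Ω → 𝕜} {ω : Ω} {k : ℕ} (hk : ∀ n, n ≠ k → y n ω = 0) (a : ℕ → 𝕜) :
    combine y a ω = a k * y k ω :=
  tsum_eq_single k fun n hn => by rw [hk n hn, mul_zero]

theorem aestronglyMeasurable_combine (hy : DisjointlySupported μ y)
    (hm : ∀ n, AEStronglyMeasurable (y n) μ) (a : ℕ → 𝕜) :
    AEStronglyMeasurable (combine y a) μ := by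
  refine aestronglyMeasurable_of_tendsto_ae atTop
    (f := fun n ω => ∑ i ∈ Finset.range n, a i * y i ω) (fun n => ?_) ?_
  · exact Finset.aestronglyMeasurable_fun_sum _ fun i _ => (hm i).const_mul _
  · filter_upwards [hy.ae_forall] with ω ⟨k, hk⟩
    rw [combine_eq_of_forall hk]
    exact (hasSum_single k fun n hn => by rw [hk n hn, mul_zero]).tendsto_sum_nat

theorem combine_sub_ae (hy : DisjointlySupported μ y) (a b : ℕ → 𝕜) :
    ∀ᵐ ω ∂μ, combine y a ω - combine y b ω = combine y (a - b) ω := by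
  filter_upwards [hy.ae_forall] with ω ⟨k, hk⟩
  simp only [combine_eq_of_forall hk, Pi.sub_apply, sub_mul]

theorem modular_combine (hM : IsMusielak M) (hy : DisjointlySupported μ y)
    (hm : ∀ n, AEStronglyMeasurable (y n) μ) (a : ℕ → 𝕜) (t : ℝ≥0) :
    modular M μ (fun ω => t * ‖combine y a ω‖₊) =
      ∑' n, modular M μ (fun ω => (t * ‖a n‖₊) * ‖y n ω‖₊) := by
  simp only [modular]
  rw [← lintegral_tsum fun n => hM.aemeasurable ((hm n).nnnorm.aemeasurable.const_mul _)]
  refine lintegral_congr_ae ?_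
  filter_upwards [hy.ae_forall] with ω ⟨k, hk⟩
  rw [combine_eq_of_forall hk, tsum_eq_single k fun n hn => by
    rw [hk n hn, nnnorm_zero, mul_zero, hM.map_zero], nnnorm_mul, mul_assoc]

theorem modular_count {F : ℝ≥0 → ℝ≥0∞} (f : ℕ → ℝ≥0) :
    modular (fun _ : ℕ => F) Measure.count f = ∑' n, F (f n) := by
  rw [modular, lintegral_count]

end General

/-! ### Functions in the closed convex hull of the powers -/

theorem psi_apply_of_ne_top {p : ℝ≥0∞} (hp : p ≠ ∞) (t : unitInterval) :
    psi p t = (t : ℝ) ^ p.toReal / p.toReal :=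
  if_neg hp

theorem psi_top_apply (t : unitInterval) : psi ∞ t = 0 := by
  simp [psi]

theorem psi_nonneg (p : ℝ≥0∞) (t : unitInterval) : 0 ≤ psi p t := by
  by_cases hp : p = ∞
  · rw [hp, psi_top_apply]
  · rw [psi_apply_of_ne_top hp]
    have := t.2.1
    positivity

theorem psi_le_inv (p : ℝ≥0∞) (t : unitInterval) : psi p t ≤ p⁻¹.toReal := by
  by_cases hp : p = ∞
  · simp [hp, psi_top_apply]
  · rw [psi_apply_of_ne_top hp, ENNReal.toReal_inv, div_eq_mul_inv]
    exact mul_le_of_le_one_left (by positivity)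
      (Real.rpow_le_one t.2.1 t.2.2 ENNReal.toReal_nonneg)

/-- Joint continuity in `(p, t)` suffices, by currying over the compact interval. At `p = ∞` it
follows from `0 ≤ ψ_p ≤ 1/p`, which is the purpose of the factor `1/p`. -/
theorem continuousOn_psi : ContinuousOn psi (Set.Ioi 0) := by
  rw [continuousOn_iff_continuous_domRestrict]
  refine ContinuousMap.continuous_of_continuous_uncurry _ (continuous_iff_continuousAt.2 ?_)
  rintro ⟨⟨p, hp⟩, t⟩
  by_cases h : p = ∞
  · subst h
    have h0 : Tendsto (fun z : Set.Ioi (0 : ℝ≥0∞) × unitInterval => (z.1 : ℝ≥0∞)⁻¹.toReal)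
        (𝓝 (⟨∞, hp⟩, t)) (𝓝 0) := by
      have : ContinuousAt (fun z : Set.Ioi (0 : ℝ≥0∞) × unitInterval => (z.1 : ℝ≥0∞)⁻¹)
          (⟨∞, hp⟩, t) := by fun_prop
      have h1 := (ENNReal.tendsto_toReal (by simp)).comp this
      simpa [Function.comp_def] using h1
    have h2 : Function.uncurry (fun (x : Set.Ioi (0 : ℝ≥0∞)) (y : unitInterval) =>
        (Set.Ioi 0).domRestrict psi x y) (⟨∞, hp⟩, t) = 0 := psi_top_apply t
    rw [ContinuousAt, h2]
    exact squeeze_zero (fun z => psi_nonneg _ _) (fun z => psi_le_inv _ _) h0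
  · have hpos : 0 < p.toReal := ENNReal.toReal_pos (ne_of_gt hp) h
    have h1 : ContinuousAt (fun z : Set.Ioi (0 : ℝ≥0∞) × unitInterval => (z.1 : ℝ≥0∞).toReal)
        (⟨p, hp⟩, t) :=
      (ENNReal.tendsto_toReal h).comp
        (continuousAt_subtype_val.comp continuousAt_fst : ContinuousAt
          (fun z : Set.Ioi (0 : ℝ≥0∞) × unitInterval => (z.1 : ℝ≥0∞)) _)
    have h2 : ContinuousAt (fun z : Set.Ioi (0 : ℝ≥0∞) × unitInterval =>
        ((z.2 : ℝ) ^ (z.1 : ℝ≥0∞).toReal / (z.1 : ℝ≥0∞).toReal)) (⟨p, hp⟩, t) :=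
      (ContinuousAt.rpow (by fun_prop) h1 (Or.inr hpos)).div h1 hpos.ne'
    refine h2.congr ?_
    have : ∀ᶠ z : Set.Ioi (0 : ℝ≥0∞) × unitInterval in 𝓝 (⟨p, hp⟩, t), (z.1 : ℝ≥0∞) ≠ ∞ :=
      (continuousAt_subtype_val.comp continuousAt_fst : ContinuousAt
          (fun z : Set.Ioi (0 : ℝ≥0∞) × unitInterval => (z.1 : ℝ≥0∞)) _).eventually_ne h
    filter_upwards [this] with z hz
    exact (psi_apply_of_ne_top hz z.2).symm

/-- `R` is closed in the compact `[0,∞]` and avoids `0`, so its image under `psi` is compact; the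
closed convex hull of a compact set in a Banach space is compact (Mazur). -/
theorem isCompact_hullK {R : Set ℝ≥0∞} (hR : IsClosed R) (h0 : 0 ∉ R) : IsCompact (hullK R) := by
  have h : IsCompact (psi '' R) := hR.isCompact.image_of_continuousOn
    (continuousOn_psi.mono fun p hp => pos_iff_ne_zero.2 fun h => h0 (h ▸ hp))
  exact isCompact_closure_of_totallyBounded_quasiComplete (𝕜 := ℝ) h.totallyBounded.convexHull

/-- The functions on `[0,1]` with lower index at least `r`. -/
def indexCone (r : ℝ) : Set C(unitInterval, ℝ) :=
  {f | ∀ s t : unitInterval, 0 ≤ f t ∧ f (s * t) ≤ (s : ℝ) ^ r * f t}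

theorem isClosed_indexCone (r : ℝ) : IsClosed (indexCone r) := by
  simp only [indexCone, Set.ofPred_forall, Set.ofPred_and]
  refine isClosed_iInter fun s => isClosed_iInter fun t => IsClosed.inter ?_ ?_
  · exact isClosed_le continuous_const (by fun_prop)
  · exact isClosed_le (by fun_prop) (by fun_prop)

theorem convex_indexCone (r : ℝ) : Convex ℝ (indexCone r) := by
  intro f hf g hg a b ha hb _ s t
  obtain ⟨hf0, hf1⟩ := hf s t
  obtain ⟨hg0, hg1⟩ := hg s t
  simp only [ContinuousMap.add_apply, ContinuousMap.smul_apply, smul_eq_mul]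
  refine ⟨by positivity, ?_⟩
  nlinarith [mul_le_mul_of_nonneg_left hf1 ha, mul_le_mul_of_nonneg_left hg1 hb]

theorem psi_mem_indexCone {r : ℝ} (hr : 0 < r) {p : ℝ≥0∞} (hp : ENNReal.ofReal r ≤ p) :
    psi p ∈ indexCone r := by
  intro s t
  refine ⟨psi_nonneg p t, ?_⟩
  by_cases h : p = ∞
  · simp [h, psi_top_apply]
  · rw [psi_apply_of_ne_top h, psi_apply_of_ne_top h, Set.Icc.coe_mul,
      Real.mul_rpow s.2.1 t.2.1, mul_div_assoc]
    have hrp : r ≤ p.toReal := (ENNReal.ofReal_le_iff_le_toReal h).1 hp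
    refine mul_le_mul_of_nonneg_right ?_ (div_nonneg (Real.rpow_nonneg t.2.1 _) (by positivity))
    exact Real.rpow_le_rpow_of_exponent_ge' s.2.1 s.2.2 hr.le hrp

/-- The defining inequalities pass to convex combinations and to limits, so it is enough to check
them on the generators. -/
theorem hullK_subset_indexCone {r : ℝ} (hr : 0 < r) {R : Set ℝ≥0∞}
    (hR : ∀ p ∈ R, ENNReal.ofReal r ≤ p) : hullK R ⊆ indexCone r :=
  closure_minimal (convexHull_min (Set.image_subset_iff.2 fun p hp =>
    psi_mem_indexCone hr (hR p hp)) (convex_indexCone r)) (isClosed_indexCone r)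

theorem indexCone_mono {r : ℝ} (hr : 0 < r) {f : C(unitInterval, ℝ)} (hf : f ∈ indexCone r) :
    Monotone f := by
  intro s t hst
  rcases eq_or_lt_of_le t.2.1 with h0 | h0
  · have : s = t := le_antisymm hst (by rw [← Subtype.coe_le_coe, ← h0]; exact s.2.1)
    rw [this]
  · let q : unitInterval := ⟨s / t, div_nonneg s.2.1 h0.le, (div_le_one h0).2 hst⟩
    have hs : s = q * t := Subtype.ext (div_mul_cancel₀ _ h0.ne').symm
    have h1 := (hf q t).2
    rw [← hs] at h1
    exact h1.trans (mul_le_of_le_one_left (hf q t).1 (Real.rpow_le_one q.2.1 q.2.2 hr.le))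

theorem indexCone_zero {r : ℝ} (hr : 0 < r) {f : C(unitInterval, ℝ)} (hf : f ∈ indexCone r) :
    f 0 = 0 := by
  have h := (hf 0 0).2
  rw [mul_zero, Set.Icc.coe_zero, Real.zero_rpow hr.ne', zero_mul] at h
  exact le_antisymm h (hf 0 0).1

/-- The extension by `∞` to `[0,∞)` of a function on `[0,1]`. -/
def extendTop (f : C(unitInterval, ℝ)) (t : ℝ≥0) : ℝ≥0∞ :=
  if t ≤ 1 then ENNReal.ofReal (f (Set.projIcc 0 1 zero_le_one t)) else ∞

theorem extendTop_of_le (f : C(unitInterval, ℝ)) {t : ℝ≥0} (ht : t ≤ 1) :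
    extendTop f t = ENNReal.ofReal (f ⟨t, t.2, ht⟩) := by
  rw [extendTop, if_pos ht]
  exact congrArg (fun z => ENNReal.ofReal (f z)) (Set.projIcc_of_mem zero_le_one ⟨t.2, ht⟩)

theorem extendTop_of_lt (f : C(unitInterval, ℝ)) {t : ℝ≥0} (ht : 1 < t) : extendTop f t = ∞ :=
  if_neg ht.not_ge

theorem extendTop_mul_le {r : ℝ} {f : C(unitInterval, ℝ)} (hf : f ∈ indexCone r)
    {s : ℝ≥0} (hs0 : 0 < s) (hs : s ≤ 1) (t : ℝ≥0) :
    extendTop f (s * t) ≤ (s : ℝ≥0∞) ^ r * extendTop f t := by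
  rcases le_or_gt t 1 with ht | ht
  · rw [extendTop_of_le f ht, extendTop_of_le f (mul_le_one' hs ht),
      ← ENNReal.ofReal_coe_nnreal, ENNReal.ofReal_rpow_of_pos (by exact_mod_cast hs0),
      ← ENNReal.ofReal_mul (by positivity)]
    exact ENNReal.ofReal_le_ofReal (hf ⟨s, s.2, hs⟩ ⟨t, t.2, ht⟩).2
  · rw [extendTop_of_lt f ht, ENNReal.mul_top]
    · exact le_top
    · exact (ENNReal.rpow_pos (by exact_mod_cast hs0) (by simp)).ne'

theorem isOrlicz_extendTop {r : ℝ} (hr : 0 < r) {f : C(unitInterval, ℝ)} (hf : f ∈ indexCone r) :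
    IsOrlicz (extendTop f) where
  monotone s t hst := by
    rcases le_or_gt t 1 with ht | ht
    · rw [extendTop_of_le f ht, extendTop_of_le f (hst.trans ht)]
      exact ENNReal.ofReal_le_ofReal (indexCone_mono hr hf hst)
    · rw [extendTop_of_lt f ht]
      exact le_top
  left_cont t := by
    have hc : Continuous fun t : ℝ≥0 =>
        ENNReal.ofReal (f (Set.projIcc 0 1 zero_le_one (t : ℝ))) := by
      have := continuous_projIcc (h := zero_le_one (α := ℝ))
      exact ENNReal.continuous_ofReal.comp (by fun_prop)
    rcases le_or_gt t 1 with ht | ht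
    · refine hc.continuousWithinAt.congr (fun s hs => ?_) ?_
      · exact if_pos ((Set.mem_Iio.1 hs).le.trans ht)
      · exact if_pos ht
    · refine ContinuousAt.continuousWithinAt ?_
      refine (continuousAt_const (y := (∞ : ℝ≥0∞))).congr ?_
      filter_upwards [lt_mem_nhds ht] with s hs
      exact (extendTop_of_lt f hs).symm
  tendsto_zero := by
    have hc : Continuous fun t : ℝ≥0 =>
        ENNReal.ofReal (f (Set.projIcc 0 1 zero_le_one (t : ℝ))) := by
      have := continuous_projIcc (h := zero_le_one (α := ℝ))
      exact ENNReal.continuous_ofReal.comp (by fun_prop)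
    have h0 := hc.tendsto 0
    rw [NNReal.coe_zero, Set.projIcc_left, show (⟨0, _⟩ : Set.Icc (0 : ℝ) 1) = 0 from rfl,
      indexCone_zero hr hf, ENNReal.ofReal_zero] at h0
    refine (h0.mono_left nhdsWithin_le_nhds).congr' ?_
    filter_upwards [mem_nhdsWithin_of_mem_nhds (ge_mem_nhds zero_lt_one)] with t ht
    exact (if_pos ht).symm
  -- The jump to `∞` past `1` supplies a positive value even when `f = 0`, as happens for `R = {∞}`.
  exists_pos := ⟨2, by rw [extendTop_of_lt f one_lt_two]; simp⟩

theorem extendTop_mem_orliczClass {r : ℝ} (hr : 0 < r) {R : Set ℝ≥0∞}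
    (hR : ∀ p ∈ R, ENNReal.ofReal r ≤ p) {f : C(unitInterval, ℝ)} (hf : f ∈ hullK R) :
    extendTop f ∈ orliczClass R := by
  refine ⟨isOrlicz_extendTop hr (hullK_subset_indexCone hr hR hf), 1, one_pos, le_rfl, f, hf, 1,
    one_pos, fun t _ => ?_⟩
  have ht : Real.toNNReal t ≤ 1 := Real.toNNReal_le_one.2 t.2.2
  have : extendTop f (Real.toNNReal t) = ENNReal.ofReal (f t) := by
    rw [extendTop_of_le f ht]
    congr 2
    exact Subtype.ext (Real.coe_toNNReal _ t.2.1)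
  simp [this]

/-! ### The modular of a function as an integral of powers -/

theorem potential_of_ne_top {p : ℝ≥0∞} (hp : p ≠ ∞) (t : ℝ≥0) :
    potential p t = (t : ℝ≥0∞) ^ p.toReal :=
  if_neg hp

theorem potential_top_of_le {t : ℝ≥0} (ht : t ≤ 1) : potential ∞ t = 0 := by
  simp [potential, ht]

theorem potential_top_of_lt {t : ℝ≥0} (ht : 1 < t) : potential ∞ t = ∞ := by
  simp [potential, ht.not_ge]

theorem potential_mono (p : ℝ≥0∞) : Monotone (potential p) := by
  intro s t hst
  by_cases hp : p = ∞
  · subst hp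
    rcases le_or_gt t 1 with ht | ht
    · rw [potential_top_of_le ht, potential_top_of_le (hst.trans ht)]
    · rw [potential_top_of_lt ht]
      exact le_top
  · rw [potential_of_ne_top hp, potential_of_ne_top hp]
    gcongr

theorem measurable_potential : Measurable fun z : ℝ≥0∞ × ℝ≥0 => potential z.1 z.2 := by
  unfold potential
  refine Measurable.ite (measurable_fst (measurableSet_singleton _)) ?_ (by fun_prop)
  exact Measurable.ite (measurable_snd measurableSet_Iic) measurable_const measurable_const

theorem potential_mul_le {r : ℝ} {p : ℝ≥0∞} (hp : ENNReal.ofReal r ≤ p) {s : ℝ≥0}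
    (hs0 : 0 < s) (hs : s ≤ 1) (t : ℝ≥0) :
    potential p (s * t) ≤ (s : ℝ≥0∞) ^ r * potential p t := by
  by_cases h : p = ∞
  · subst h
    rcases le_or_gt t 1 with ht | ht
    · simp [potential_top_of_le (mul_le_one' hs ht)]
    · rw [potential_top_of_lt ht, ENNReal.mul_top]
      · exact le_top
      · exact (ENNReal.rpow_pos (by exact_mod_cast hs0) (by simp)).ne'
  · rw [potential_of_ne_top h, potential_of_ne_top h, ENNReal.coe_mul,
      ENNReal.mul_rpow_of_nonneg _ _ ENNReal.toReal_nonneg]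
    gcongr ?_ * _
    exact ENNReal.rpow_le_rpow_of_exponent_ge (by exact_mod_cast hs)
      ((ENNReal.ofReal_le_iff_le_toReal h).1 hp)

theorem self_le_two_rpow {p : ℝ} (hp : 0 ≤ p) : p ≤ 2 ^ p := by
  rcases le_total p 1 with h | h
  · exact h.trans (Real.one_le_rpow one_le_two hp)
  · have := one_add_mul_self_le_rpow_one_add (s := 1) (by norm_num) h
    norm_num at this
    linarith

/-- Halving the argument gains `2^p ≥ p`, which absorbs the weight `p`. For `p = ∞` the convention
`∞ * 0 = 0` makes the left side vanish. -/
theorem mul_potential_half_le {p : ℝ≥0∞} {t : ℝ≥0} (h : p = ∞ → t ≤ 1) :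
    p * potential p (t / 2) ≤ potential p t := by
  by_cases hp : p = ∞
  · have ht := h hp
    subst hp
    rw [potential_top_of_le, mul_zero]
    · exact zero_le
    · exact (half_le_self (zero_le)).trans ht
  · have h2 : (t : ℝ≥0∞) = 2 * (t / 2 : ℝ≥0) := by
      rw [← ENNReal.coe_ofNat, ← ENNReal.coe_mul, mul_div_cancel₀ _ two_ne_zero]
    rw [potential_of_ne_top hp, potential_of_ne_top hp, h2,
      ENNReal.mul_rpow_of_nonneg _ _ ENNReal.toReal_nonneg]
    gcongr
    rw [← ENNReal.ofReal_toReal hp, ENNReal.toReal_ofReal ENNReal.toReal_nonneg,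
      ← ENNReal.ofReal_ofNat 2, ENNReal.ofReal_rpow_of_pos two_pos]
    exact ENNReal.ofReal_le_ofReal (self_le_two_rpow ENNReal.toReal_nonneg)

theorem potential_mul_half_eq {p : ℝ≥0∞} (hp0 : p ≠ 0) {g : ℝ≥0} (h : p = ∞ → g ≤ 1)
    (t : unitInterval) :
    potential p (Real.toNNReal t * (g / 2)) =
      p * potential p (g / 2) * ENNReal.ofReal (psi p t) := by
  by_cases hp : p = ∞
  · have hg := h hp
    subst hp
    have h2 : g / 2 ≤ 1 := (half_le_self (zero_le)).trans hg
    rw [psi_top_apply, ENNReal.ofReal_zero, mul_zero, potential_top_of_le]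
    exact mul_le_one' (Real.toNNReal_le_one.2 t.2.2) h2
  · have hpos := ENNReal.toReal_pos hp0 hp
    rw [potential_of_ne_top hp, potential_of_ne_top hp, psi_apply_of_ne_top hp, ENNReal.coe_mul,
      ENNReal.mul_rpow_of_nonneg _ _ ENNReal.toReal_nonneg, ENNReal.ofReal_div_of_pos hpos,
      ENNReal.ofReal_toReal hp, ← ENNReal.ofReal_rpow_of_nonneg t.2.1 hpos.le, mul_comm p,
      mul_assoc, ENNReal.mul_div_cancel hp0 hp, mul_comm]
    rfl

/-- `Φ_p(Kg) = (2K)^p Φ_p(g/2)`, with `(2K)^p ≤ (2K)^q` and `1 ≤ p/r`. For bounded exponents this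
bounds the mass of the representing measure from below. -/
theorem potential_mul_le_mul_half {r q : ℝ} (hr : 0 < r) {p : ℝ≥0∞} (hrp : ENNReal.ofReal r ≤ p)
    (hpq : p ≤ ENNReal.ofReal q) {K : ℝ≥0} (hK : 1 ≤ K) (g : ℝ≥0) :
    potential p (K * g) ≤
      ENNReal.ofReal ((2 * K) ^ q / r) * (p * potential p (g / 2)) := by
  have hp : p ≠ ∞ := ne_top_of_le_ne_top ENNReal.ofReal_ne_top hpq
  have hrp' : r ≤ p.toReal := (ENNReal.ofReal_le_iff_le_toReal hp).1 hrp
  have hpq' : p.toReal ≤ q := ENNReal.toReal_le_of_le_ofReal (by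
    by_contra! hq
    rw [ENNReal.ofReal_of_nonpos hq.le] at hpq
    exact absurd ((ENNReal.ofReal_pos.2 hr).trans_le (hrp.trans hpq)) (lt_irrefl _)) hpq
  have h2 : K * g = (2 * K) * (g / 2) := by
    rw [mul_comm 2, mul_assoc, mul_div_cancel₀ _ two_ne_zero]
  have hK1 : (1 : ℝ) ≤ 2 * K := by
    have : (1 : ℝ) ≤ K := by exact_mod_cast hK
    linarith
  rw [potential_of_ne_top hp, potential_of_ne_top hp, h2, ENNReal.coe_mul,
    ENNReal.mul_rpow_of_nonneg _ _ ENNReal.toReal_nonneg, ← mul_assoc]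
  gcongr
  rw [← ENNReal.ofReal_coe_nnreal, ENNReal.ofReal_rpow_of_pos (by push_cast; linarith)]
  nth_rw 2 [← ENNReal.ofReal_toReal hp]
  rw [← ENNReal.ofReal_mul (by positivity)]
  refine ENNReal.ofReal_le_ofReal ?_
  rw [div_mul_eq_mul_div, le_div_iff₀ hr]
  push_cast
  gcongr

section Exponent

variable {Ω : Type*} [MeasurableSpace Ω] {μ : Measure Ω} {P : Ω → ℝ≥0∞}

theorem isMusielak_expMO (hPm : Measurable P) (hP : ∀ ω, 0 < P ω) : IsMusielak (expMO P) where
  monotone ω := potential_mono _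
  map_zero ω := by
    by_cases h : P ω = ∞
    · simp [expMO, h, potential_top_of_le]
    · rw [expMO, potential_of_ne_top h, ENNReal.coe_zero,
        ENNReal.zero_rpow_of_pos (ENNReal.toReal_pos (hP ω).ne' h)]
  measurable := measurable_potential.comp
    ((hPm.comp measurable_fst).prodMk measurable_snd)

theorem ae_mem_essRange (hPm : Measurable P) : ∀ᵐ ω ∂μ, P ω ∈ essRange P μ :=
  ae_of_ae_map hPm.aemeasurable Measure.support_mem_ae

/-- `φ` is the Bochner average of `psi` over `ν`: averages stay in a closed convex set, and
evaluation at `t` commutes with the integral. -/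
theorem exists_hullK_lintegral_psi {r : ℝ} (hr : 0 < r) {R : Set ℝ≥0∞}
    (hR : ∀ p ∈ R, ENNReal.ofReal r ≤ p) (ν : Measure ℝ≥0∞) [IsFiniteMeasure ν] [NeZero ν]
    (hν : ∀ᵐ p ∂ν, p ∈ R) :
    ∃ φ ∈ hullK R, ∀ t, ∫⁻ p, ENNReal.ofReal (psi p t) ∂ν = ν Set.univ * ENNReal.ofReal (φ t) := by
  have hpos : ∀ p ∈ R, 0 < p := fun p hp => (ENNReal.ofReal_pos.2 hr).trans_le (hR p hp)
  have hm : AEStronglyMeasurable psi ν := by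
    have h1 := continuousOn_psi.aestronglyMeasurable (μ := ν) measurableSet_Ioi
    rwa [Measure.restrict_eq_self_of_ae_mem (s := Set.Ioi 0) (hν.mono hpos)] at h1
  have hint : Integrable psi ν := by
    refine .of_bound hm r⁻¹ (hν.mono fun p hp => ?_)
    refine (ContinuousMap.norm_le _ (by positivity)).2 fun t => ?_
    rw [Real.norm_of_nonneg (psi_nonneg p t)]
    refine (psi_le_inv p t).trans ?_
    rw [← ENNReal.toReal_ofReal hr.le, ← ENNReal.toReal_inv]
    refine ENNReal.toReal_mono (by simpa using hr) (ENNReal.inv_le_inv.2 (hR p hp))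
  refine ⟨⨍ p, psi p ∂ν, ?_, fun t => ?_⟩
  · refine ((convex_convexHull ℝ _).closure).average_mem isClosed_closure (hν.mono fun p hp => ?_)
      hint
    exact subset_closure (subset_convexHull ℝ _ ⟨p, hp, rfl⟩)
  · have h1 : ENNReal.ofReal (∫ p, psi p t ∂ν) = ∫⁻ p, ENNReal.ofReal (psi p t) ∂ν :=
      ofReal_integral_eq_lintegral_ofReal
      ((ContinuousMap.evalCLM ℝ t).integrable_comp hint) (.of_forall fun p => psi_nonneg p t)
    rw [← h1, average_eq, ContinuousMap.smul_apply, ContinuousMap.integral_apply hint, smul_eq_mul,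
      ENNReal.ofReal_mul (by positivity), ← mul_assoc,
      ENNReal.ofReal_inv_of_pos, ofReal_measureReal, ENNReal.mul_inv_cancel, one_mul]
    · exact NeZero.ne _
    · exact measure_ne_top _ _
    · exact measureReal_univ_pos

/-- The constant `m` is chosen before `g`, so it is uniform along the sequence. -/
theorem exists_hullK_modular (hPm : Measurable P) (hP : ∀ ω, 0 < P ω) {r : ℝ} (hr : 0 < r)
    (hR : ∀ p ∈ essRange P μ, ENNReal.ofReal r ≤ p) {K : ℝ≥0} (hK : 1 ≤ K) :
    ∃ m : ℝ≥0, 0 < m ∧ ∀ g : Ω → ℝ≥0, AEMeasurable g μ → modular (expMO P) μ g ≤ 1 →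
      1 ≤ modular (expMO P) μ (fun ω => K * g ω) →
      ∃ φ ∈ hullK (essRange P μ), ∀ t ≤ 1,
        modular (expMO P) μ (fun ω => t * (g ω / 2)) ≤ extendTop φ t ∧
        m * extendTop φ t ≤ modular (expMO P) μ (fun ω => t * (g ω / 2)) := by
  have hM := isMusielak_expMO hPm hP
  have key : ∀ g : Ω → ℝ≥0, AEMeasurable g μ → modular (expMO P) μ g ≤ 1 →
      ∃ ν : Measure ℝ≥0∞, ν Set.univ = ∫⁻ ω, P ω * potential (P ω) (g ω / 2) ∂μ ∧
        ν Set.univ ≤ 1 ∧ (∀ᵐ p ∂ν, p ∈ essRange P μ) ∧ ∀ t : unitInterval,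
        modular (expMO P) μ (fun ω => Real.toNNReal t * (g ω / 2)) =
          ∫⁻ p, ENNReal.ofReal (psi p t) ∂ν := by
    intro g hg h1
    have htop : ∀ᵐ ω ∂μ, P ω = ∞ → g ω ≤ 1 := by
      have : ∀ᵐ ω ∂μ, expMO P ω (g ω) < ∞ :=
        ae_lt_top' (hM.aemeasurable hg) (h1.trans_lt ENNReal.one_lt_top).ne
      filter_upwards [this] with ω hω hPω
      by_contra! h
      rw [expMO, hPω, potential_top_of_lt h] at hω
      exact lt_irrefl _ hω
    have hd : AEMeasurable (fun ω => P ω * potential (P ω) (g ω / 2)) μ :=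
      hPm.aemeasurable.mul (hM.aemeasurable (hg.div_const 2))
    have huniv : ((μ.withDensity fun ω => P ω * potential (P ω) (g ω / 2)).map P) Set.univ =
        ∫⁻ ω, P ω * potential (P ω) (g ω / 2) ∂μ := by
      rw [Measure.map_apply hPm .univ, Set.preimage_univ, withDensity_apply _ .univ,
        Measure.restrict_univ]
    refine ⟨(μ.withDensity fun ω => P ω * potential (P ω) (g ω / 2)).map P, huniv, ?_, ?_, ?_⟩
    · rw [huniv]
      exact (lintegral_mono_ae (htop.mono fun ω h => mul_potential_half_le h)).trans h1
    · exact ((withDensity_absolutelyContinuous _ _).map hPm).ae_le Measure.support_mem_ae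
    · intro t
      have hpsi : Measurable fun p => ENNReal.ofReal (psi p t) := by
        refine ENNReal.measurable_ofReal.comp (Measurable.ite (measurableSet_singleton _)
          measurable_const (by fun_prop))
      rw [lintegral_map hpsi hPm, lintegral_withDensity_eq_lintegral_mul₀ hd
        (g := fun ω => ENNReal.ofReal (psi (P ω) t)) (hpsi.comp hPm).aemeasurable]
      refine lintegral_congr_ae (htop.mono fun ω h => ?_)
      exact potential_mul_half_eq (hP ω).ne' h t
  have ext : ∀ (φ : C(unitInterval, ℝ)) (t : ℝ≥0) (ht : t ≤ 1), ∃ s : unitInterval,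
      Real.toNNReal s = t ∧ extendTop φ t = ENNReal.ofReal (φ s) := fun φ t ht =>
    ⟨⟨t, t.2, ht⟩, Real.toNNReal_coe, extendTop_of_le φ ht⟩
  by_cases hinf : ∞ ∈ essRange P μ
  · refine ⟨1, one_pos, fun g hg h1 _ => ?_⟩
    obtain ⟨ν, -, hν1, hνR, hν⟩ := key g hg h1
    have hfin : IsFiniteMeasure ν := ⟨hν1.trans_lt ENNReal.one_lt_top⟩
    -- The Dirac mass at `∞` completes `ν` to a probability measure without changing any integral of
    -- `ψ_p(t)`.
    have hprob : IsProbabilityMeasure (ν + (1 - ν Set.univ) • Measure.dirac ∞) :=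
      ⟨by simp [add_tsub_cancel_of_le hν1]⟩
    obtain ⟨φ, hφ, h⟩ := exists_hullK_lintegral_psi hr hR
      (ν + (1 - ν Set.univ) • Measure.dirac ∞) (by
        rw [ae_add_measure_iff]
        exact ⟨hνR, Measure.smul_absolutelyContinuous.ae_le ((ae_dirac_iff
          Measure.isClosed_support.measurableSet).2 hinf)⟩)
    refine ⟨φ, hφ, fun t ht => ?_⟩
    obtain ⟨s, rfl, hs⟩ := ext φ t ht
    have := h s
    simp only [measure_univ, one_mul, lintegral_add_measure, lintegral_smul_measure,
      lintegral_dirac, psi_top_apply, ENNReal.ofReal_zero, smul_zero, add_zero] at this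
    rw [hs, hν s, this]
    simp
  -- The essential range is closed in `[0,∞]`, so omitting `∞` makes it bounded.
  · obtain ⟨q, hq⟩ : ∃ q : ℝ, ∀ p ∈ essRange P μ, p ≤ ENNReal.ofReal q := by
      by_cases hne : (essRange P μ).Nonempty
      · have hc : IsCompact (essRange P μ) := Measure.isClosed_support.isCompact
        have hmem := hc.sSup_mem hne
        have hsup : sSup (essRange P μ) ≠ ∞ := fun h => hinf (h ▸ hmem)
        exact ⟨(sSup (essRange P μ)).toReal, fun p hp => by
          rw [ENNReal.ofReal_toReal hsup]; exact le_sSup hp⟩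
      · exact ⟨0, fun p hp => (hne ⟨p, hp⟩).elim⟩
    have hCpos : 0 < (2 * (K : ℝ)) ^ q / r := by
      have : (0 : ℝ) < K := by exact_mod_cast one_pos.trans_le hK
      positivity
    refine ⟨(Real.toNNReal ((2 * K) ^ q / r))⁻¹, inv_pos.2 (Real.toNNReal_pos.2 hCpos),
      fun g hg h1 h2 => ?_⟩
    obtain ⟨ν, hνu, hν1, hνR, hν⟩ := key g hg h1
    have hfin : IsFiniteMeasure ν := ⟨hν1.trans_lt ENNReal.one_lt_top⟩
    have hC : 1 ≤ ENNReal.ofReal ((2 * K) ^ q / r) * ν Set.univ := by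
      rw [hνu, ← lintegral_const_mul' _ _ ENNReal.ofReal_ne_top]
      refine h2.trans (lintegral_mono_ae ?_)
      filter_upwards [ae_mem_essRange hPm] with ω hω
      exact potential_mul_le_mul_half hr (hR _ hω) (hq _ hω) hK _
    have hm : ((Real.toNNReal ((2 * K) ^ q / r))⁻¹ : ℝ≥0) ≤ ν Set.univ := by
      rw [ENNReal.coe_inv (Real.toNNReal_pos.2 hCpos).ne', ENNReal.inv_le_iff_le_mul]
      · exact hC
      · simp
      · simp
    have hne : NeZero ν := ⟨fun h => by simp [h] at hC⟩
    obtain ⟨φ, hφ, h⟩ := exists_hullK_lintegral_psi hr hR ν hνR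
    refine ⟨φ, hφ, fun t ht => ?_⟩
    obtain ⟨s, rfl, hs⟩ := ext φ t ht
    rw [hs, hν s, h s]
    exact ⟨mul_le_of_le_one_left (zero_le) hν1, by gcongr⟩

end Exponent

/-! ### Comparison of modulars on sequences -/

/-- The modular `A` is homogeneous of lower degree `r`. -/
def LowerIndex (r : ℝ) (A : (ℕ → ℝ≥0) → ℝ≥0∞) : Prop :=
  ∀ s : ℝ≥0, 0 < s → s ≤ 1 → ∀ b, A (fun n => s * b n) ≤ (s : ℝ≥0∞) ^ r * A b

/-- The half ball of the modular `B` is bounded for the modular `A`. -/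
def Dominates (B A : (ℕ → ℝ≥0) → ℝ≥0∞) : Prop :=
  ∃ k : ℝ≥0, 0 < k ∧ ∃ C : ℝ≥0, ∀ b, B b ≤ 1 / 2 → A (fun n => k * b n) ≤ C

theorem exists_rpow_mul_lt {r : ℝ} (hr : 0 < r) (C : ℝ≥0) {ε : ℝ≥0} (hε : 0 < ε) :
    ∃ s : ℝ≥0, 0 < s ∧ s ≤ 1 ∧ (s : ℝ≥0∞) ^ r * C < ε := by
  have hc : Continuous fun s : ℝ≥0 => s ^ r * C :=
    (NNReal.continuous_rpow_const hr.le).mul continuous_const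
  have h0 := hc.tendsto 0
  simp only [NNReal.zero_rpow hr.ne', zero_mul] at h0
  have h1 : ∀ᶠ s : ℝ≥0 in 𝓝[>] 0, s ^ r * C < ε :=
    nhdsWithin_le_nhds (h0.eventually_lt_const hε)
  have h2 : ∀ᶠ s : ℝ≥0 in 𝓝[>] 0, s ≤ 1 :=
    nhdsWithin_le_nhds (ge_mem_nhds zero_lt_one)
  obtain ⟨s, hs1, hs2, hs0⟩ := (h1.and (h2.and self_mem_nhdsWithin)).exists
  refine ⟨s, hs0, hs2, ?_⟩
  rw [← ENNReal.coe_rpow_of_nonneg _ hr.le]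
  exact_mod_cast hs1

section Comparison

variable {r : ℝ} {A B : (ℕ → ℝ≥0) → ℝ≥0∞}

/-- The dilation `v = s k u` writes `b / u` as `s · k · (b / v)`; the factor `s^r` then shrinks the
bound `C` below `ε`. -/
theorem Dominates.small (h : Dominates B A) (hr : 0 < r) (hA : LowerIndex r A) {u ε : ℝ≥0}
    (hu : 0 < u) (hε : 0 < ε) : ∃ v : ℝ≥0, 0 < v ∧ ∃ δ : ℝ≥0, 0 < δ ∧
      ∀ b : ℕ → ℝ≥0, B (fun n => b n / v) < δ → A (fun n => b n / u) < ε := by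
  obtain ⟨k, hk, C, hC⟩ := h
  obtain ⟨s, hs0, hs1, hs⟩ := exists_rpow_mul_lt hr C hε
  refine ⟨s * k * u, by positivity, 1 / 2, by positivity, fun b hb => ?_⟩
  have h1 := hC _ (hb.le.trans_eq (by simp))
  have h2 := (hA s hs0 hs1 _).trans (mul_le_mul_right h1 _)
  refine lt_of_eq_of_lt ?_ (h2.trans_lt hs)
  congr 1
  ext n
  congr 1
  field_simp

theorem Dominates.finite (h : Dominates B A) (hr : 0 < r) (hB : LowerIndex r B) {b : ℕ → ℝ≥0}
    (hb : ∃ t : ℝ≥0, 0 < t ∧ B (fun n => t * b n) < ∞) :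
    ∃ t : ℝ≥0, 0 < t ∧ A (fun n => t * b n) < ∞ := by
  obtain ⟨k, hk, C, hC⟩ := h
  obtain ⟨t, ht, htb⟩ := hb
  lift B (fun n => t * b n) to ℝ≥0 using htb.ne with D hD
  obtain ⟨s, hs0, hs1, hs⟩ := exists_rpow_mul_lt hr D (ε := 1 / 2) (by positivity)
  have h1 := hB s hs0 hs1 fun n => t * b n
  rw [← hD] at h1
  have h2 := hC _ (h1.trans (hs.le.trans_eq (by simp)))
  refine ⟨k * (s * t), by positivity, lt_of_eq_of_lt ?_ (h2.trans_lt ENNReal.coe_lt_top)⟩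
  simp only [mul_assoc]

variable {Ω : Type*} [MeasurableSpace Ω] {𝕜 : Type*} [RCLike 𝕜]
  {M : Ω → ℝ≥0 → ℝ≥0∞} {μ : Measure Ω} {y : ℕ → Ω → 𝕜} {F : ℝ≥0 → ℝ≥0∞}

/-- The modular that a disjointly supported sequence induces on its coefficients. -/
def coeffModular (M : Ω → ℝ≥0 → ℝ≥0∞) (μ : Measure Ω) (y : ℕ → Ω → 𝕜) (b : ℕ → ℝ≥0) : ℝ≥0∞ :=
  ∑' n, modular M μ fun ω => b n * ‖y n ω‖₊

theorem coeffSpace_eq_orliczSeqSpace (hM : IsMusielak M) (hr : 0 < r)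
    (hy : DisjointlySupported μ y) (hm : ∀ n, AEStronglyMeasurable (y n) μ)
    (hA : LowerIndex r (coeffModular M μ y)) (hB : LowerIndex r fun b => ∑' n, F (b n))
    (hBA : Dominates (fun b => ∑' n, F (b n)) (coeffModular M μ y))
    (hAB : Dominates (coeffModular M μ y) fun b => ∑' n, F (b n)) :
    coeffSpace M μ y = orliczSeqSpace 𝕜 F := by
  ext a
  have h1 : a ∈ coeffSpace M μ y ↔
      ∃ t : ℝ≥0, 0 < t ∧ coeffModular M μ y (fun n => t * ‖a n‖₊) < ∞ := by
    simp only [coeffSpace, moSpace, Set.mem_ofPred_eq, aestronglyMeasurable_combine hy hm a,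
      modular_combine hM hy hm, coeffModular, true_and]
  have h2 : a ∈ orliczSeqSpace 𝕜 F ↔ ∃ t : ℝ≥0, 0 < t ∧ ∑' n, F (t * ‖a n‖₊) < ∞ := by
    simp only [orliczSeqSpace, moSpace, Set.mem_ofPred_eq, modular_count, and_iff_right_iff_imp]
    exact fun _ => .of_discrete
  rw [h1, h2]
  exact ⟨fun h => hAB.finite hr hA h, fun h => hBA.finite hr hB h⟩

theorem coeffTopology_eq_induced (hM : IsMusielak M) (hF : IsMusielak fun _ : ℕ => F) (hr : 0 < r)
    (hy : DisjointlySupported μ y) (hm : ∀ n, AEStronglyMeasurable (y n) μ)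
    (hA : LowerIndex r (coeffModular M μ y)) (hB : LowerIndex r fun b => ∑' n, F (b n))
    (hBA : Dominates (fun b => ∑' n, F (b n)) (coeffModular M μ y))
    (hAB : Dominates (coeffModular M μ y) fun b => ∑' n, F (b n))
    (h : coeffSpace M μ y = orliczSeqSpace 𝕜 F) :
    coeffTopology M μ y = (orliczSeqTopology 𝕜 F).induced (Set.inclusion h.subset) := by
  have e1 : ∀ (a c : ℕ → 𝕜) (u : ℝ≥0),
      modular M μ (fun ω => ‖combine y c ω - combine y a ω‖₊ / u) =
        coeffModular M μ y (fun n => ‖c n - a n‖₊ / u) := by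
    intro a c u
    have : modular M μ (fun ω => ‖combine y c ω - combine y a ω‖₊ / u) =
        modular M μ (fun ω => u⁻¹ * ‖combine y (c - a) ω‖₊) := by
      refine lintegral_congr_ae ((combine_sub_ae hy c a).mono fun ω hω => ?_)
      simp only [hω, div_eq_inv_mul]
    rw [this, modular_combine hM hy hm]
    simp only [coeffModular, div_eq_inv_mul, Pi.sub_apply]
  refine TopologicalSpace.ext_nhds fun a => ?_
  rw [coeffTopology, @nhds_induced _ _ (moTopology 𝕜 M μ),
    @nhds_induced _ _ (orliczSeqTopology 𝕜 F)]
  ext S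
  rw [mem_comap, mem_comap]
  constructor
  · rintro ⟨T, hT, hTS⟩
    obtain ⟨u, hu, ε, hε, hT⟩ := (mem_nhds_moTopology hM).1 hT
    obtain ⟨v, hv, δ, hδ, hvδ⟩ := hBA.small hr hA hu hε
    refine ⟨{c | modular (fun _ : ℕ => F) Measure.count
      (fun n => ‖(c : ℕ → 𝕜) n - (a : ℕ → 𝕜) n‖₊ / v) < δ},
      (mem_nhds_moTopology hF).2 ⟨v, hv, δ, hδ, fun c hc => hc⟩, fun c hc => hTS (hT _ ?_)⟩
    refine (e1 a c u).trans_lt (hvδ _ ?_)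
    rw [← modular_count]
    exact hc
  · rintro ⟨T, hT, hTS⟩
    obtain ⟨u, hu, ε, hε, hT⟩ := (mem_nhds_moTopology hF).1 hT
    obtain ⟨v, hv, δ, hδ, hvδ⟩ := hAB.small hr hB hu hε
    refine ⟨{f | modular M μ (fun ω => ‖(f : Ω → 𝕜) ω - combine y a ω‖₊ / v) < δ},
      (mem_nhds_moTopology hM).2 ⟨v, hv, δ, hδ, fun c hc => hc⟩, fun c hc => hTS (hT _ ?_)⟩
    rw [modular_count]
    exact hvδ _ ((e1 a c v).symm.trans_lt hc)

end Comparison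

/-! ### The sequence modular of an extended function, and its stability under perturbation -/

theorem isMusielak_extendTop {r : ℝ} (hr : 0 < r) {φ : C(unitInterval, ℝ)}
    (hφ : φ ∈ indexCone r) : IsMusielak fun _ : ℕ => extendTop φ where
  monotone _ := (isOrlicz_extendTop hr hφ).monotone
  map_zero _ := by
    rw [extendTop_of_le φ zero_le_one]
    exact ENNReal.ofReal_eq_zero.2 (indexCone_zero hr hφ).le
  measurable := (isOrlicz_extendTop hr hφ).monotone.measurable.comp measurable_snd

theorem lowerIndex_extendTop {r : ℝ} {φ : C(unitInterval, ℝ)} (hφ : φ ∈ indexCone r) :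
    LowerIndex r fun b => ∑' n, extendTop φ (b n) := by
  intro s hs0 hs1 b
  rw [← ENNReal.tsum_mul_left]
  exact ENNReal.tsum_le_tsum fun n => extendTop_mul_le hφ hs0 hs1 _

theorem extendTop_le_add {φ ψ : C(unitInterval, ℝ)} {n : ℕ} (h : dist φ ψ < (1 / 2) ^ n)
    (t : ℝ≥0) : extendTop φ t ≤ extendTop ψ t + 2⁻¹ ^ n := by
  rcases le_or_gt t 1 with ht | ht
  · rw [extendTop_of_le _ ht, extendTop_of_le _ ht]
    have h1 := (ContinuousMap.dist_apply_le_dist ⟨t, t.2, ht⟩).trans_lt h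
    rw [Real.dist_eq] at h1
    refine (ENNReal.ofReal_le_ofReal (q := ψ ⟨t, t.2, ht⟩ + (1 / 2) ^ n)
      (by linarith [le_abs_self (φ ⟨t, t.2, ht⟩ - ψ ⟨t, t.2, ht⟩)])).trans ?_
    refine ENNReal.ofReal_add_le.trans_eq ?_
    rw [ENNReal.ofReal_pow (by positivity), one_div, ENNReal.ofReal_inv_of_pos two_pos,
      ENNReal.ofReal_ofNat]
  · rw [extendTop_of_lt ψ ht, top_add]
    exact le_top

theorem tsum_extendTop_le_add {φ : ℕ → C(unitInterval, ℝ)} {ψ : ℕ → C(unitInterval, ℝ)}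
    (h : ∀ n, dist (φ n) (ψ n) < (1 / 2) ^ n) (b : ℕ → ℝ≥0) :
    ∑' n, extendTop (φ n) (b n) ≤ ∑' n, extendTop (ψ n) (b n) + 2 := by
  refine (ENNReal.tsum_le_tsum fun n => extendTop_le_add (h n) (b n)).trans_eq ?_
  rw [ENNReal.tsum_add, ENNReal.tsum_geometric, ENNReal.one_sub_inv_two, inv_inv]

/-! ### Modular bounds from bounds on the Luxemburg functional -/

section Luxemburg

variable {Ω : Type*} [MeasurableSpace Ω] {𝕜 : Type*} [RCLike 𝕜]
  {M : Ω → ℝ≥0 → ℝ≥0∞} {μ : Measure Ω}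

theorem modular_lt_one_of_luxemburg_lt (hM : IsMusielak M) {f : Ω → 𝕜} {b : ℝ≥0}
    (h : luxemburg M μ f < b) : modular M μ (fun ω => b⁻¹ * ‖f ω‖₊) < 1 := by
  simp only [luxemburg, iInf_lt_iff] at h
  obtain ⟨t, ht, h1, htb⟩ := h
  refine (modular_mono hM (.of_forall fun ω => ?_)).trans_lt h1
  rw [div_eq_inv_mul]
  have : t ≤ b := by exact_mod_cast htb.le
  gcongr

theorem one_le_modular_of_lt_luxemburg {f : Ω → 𝕜} {a : ℝ≥0} (ha : 0 < a)
    (h : a < luxemburg M μ f) : 1 ≤ modular M μ (fun ω => a⁻¹ * ‖f ω‖₊) := by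
  by_contra! h1
  refine h.not_ge (iInf₂_le_of_le a ha (iInf_le_of_le ?_ le_rfl))
  simpa only [div_eq_inv_mul] using h1

end Luxemburg

/-! ### Choice of the subsequence and of the limit function -/

section Exponent

variable {Ω : Type*} [MeasurableSpace Ω] {𝕜 : Type*} [RCLike 𝕜] {μ : Measure Ω} {P : Ω → ℝ≥0∞}

theorem lowerIndex_coeffModular (hPm : Measurable P) {r : ℝ}
    (hR : ∀ p ∈ essRange P μ, ENNReal.ofReal r ≤ p) (y : ℕ → Ω → 𝕜) :
    LowerIndex r (coeffModular (expMO P) μ y) := by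
  intro s hs0 hs1 b
  simp only [coeffModular, modular]
  rw [← ENNReal.tsum_mul_left]
  refine ENNReal.tsum_le_tsum fun n => ?_
  rw [← lintegral_const_mul' _ _ (by
    rw [← ENNReal.coe_rpow_of_ne_zero hs0.ne']; exact ENNReal.coe_ne_top)]
  refine lintegral_mono_ae ?_
  filter_upwards [ae_mem_essRange hPm] with ω hω
  rw [mul_assoc]
  exact potential_mul_le (hR _ hω) hs0 hs1 _

theorem exists_extendTop_dominates (hPm : Measurable P) (hP : ∀ ω, 0 < P ω) {r : ℝ} (hr : 0 < r)
    (hR : ∀ p ∈ essRange P μ, ENNReal.ofReal r ≤ p) {x : ℕ → Ω → 𝕜}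
    (hx : SemiNormalized (expMO P) μ x) :
    ∃ σ : ℕ → ℕ, StrictMono σ ∧ ∃ φ ∈ hullK (essRange P μ),
      Dominates (fun b => ∑' n, extendTop φ (b n)) (coeffModular (expMO P) μ (x ∘ σ)) ∧
      Dominates (coeffModular (expMO P) μ (x ∘ σ)) fun b => ∑' n, extendTop φ (b n) := by
  have hM := isMusielak_expMO hPm hP
  obtain ⟨hmem, a, b, ha, hab⟩ := hx
  obtain ⟨s, hs, hs1⟩ : ∃ s : ℝ≥0, 0 < s ∧
      ∀ n, modular (expMO P) μ (fun ω => s * ‖x n ω‖₊) ≤ 1 := by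
    refine ⟨(b + 1)⁻¹, by positivity, fun n => (modular_lt_one_of_luxemburg_lt hM ?_).le⟩
    refine (hab n).2.trans_lt ?_
    exact_mod_cast lt_add_one b
  obtain ⟨t, hst, ht1⟩ : ∃ t : ℝ≥0, s ≤ t ∧
      ∀ n, 1 ≤ modular (expMO P) μ (fun ω => t * ‖x n ω‖₊) := by
    -- Halving `a` makes the inequality strict; the maximum ensures `t ≥ s`, hence `K = t / s ≥ 1`.
    refine ⟨max s (a / 2)⁻¹, le_max_left _ _, fun n =>
      (one_le_modular_of_lt_luxemburg (f := x n) (half_pos ha) ?_).trans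
        (modular_mono hM (.of_forall fun ω => ?_))⟩
    · refine lt_of_lt_of_le ?_ (hab n).1
      exact_mod_cast half_lt_self ha
    · gcongr
      exact le_max_right _ _
  have ht : 0 < t := hs.trans_le hst
  obtain ⟨m, hm, hφ⟩ := exists_hullK_modular hPm hP hr hR ((one_le_div hs).2 hst)
  have hmeas : ∀ n, AEMeasurable (fun ω => s * ‖x n ω‖₊) μ := fun n =>
    (hmem n).1.nnnorm.aemeasurable.const_mul s
  have hK : ∀ n, 1 ≤ modular (expMO P) μ (fun ω => t / s * (s * ‖x n ω‖₊)) := by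
    simpa only [← mul_assoc, div_mul_cancel₀ _ hs.ne'] using ht1
  choose φ hφK hφ using fun n => hφ (fun ω => s * ‖x n ω‖₊) (hmeas n) (hs1 n) (hK n)
  have h0 : 0 ∉ essRange P μ := fun h => (ENNReal.ofReal_pos.2 hr).not_ge (hR 0 h)
  obtain ⟨ψ, hψ, τ, hτ, hlim⟩ :=
    (isCompact_hullK Measure.isClosed_support h0).tendsto_subseq hφK
  -- A second extraction makes the distances to the limit summable.
  obtain ⟨τ', hτ', hdist⟩ := extraction_forall_of_eventually (P := fun n k =>
    dist (φ (τ k)) ψ < (1 / 2) ^ n) fun n =>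
      hlim.eventually (Metric.ball_mem_nhds ψ (by positivity))
  refine ⟨τ ∘ τ', hτ.comp hτ', ψ, hψ, ⟨s / 2, half_pos hs, 1 / 2 + 2, fun b hb => ?_⟩,
    t⁻¹, inv_pos.2 ht, m⁻¹ * (1 / 2) + 2, fun b hb => ?_⟩
  -- The comparison with `φₙ` holds only on `[0,1]`; the value `∞` past `1` keeps the coefficients
  -- there.
  · have hb1 : ∀ n, b n ≤ 1 := by
      intro n
      by_contra! h
      have := (ENNReal.le_tsum n).trans hb
      rw [extendTop_of_lt ψ h] at this
      simp at this
    calc coeffModular (expMO P) μ (x ∘ τ ∘ τ') (fun n => s / 2 * b n)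
        ≤ ∑' n, extendTop (φ (τ (τ' n))) (b n) := by
          refine ENNReal.tsum_le_tsum fun n => le_of_eq_of_le ?_ (hφ (τ (τ' n)) (b n) (hb1 n)).1
          congr 1
          ext ω
          push_cast [Function.comp_apply]
          ring
      _ ≤ ∑' n, extendTop ψ (b n) + 2 := tsum_extendTop_le_add hdist b
      _ ≤ 1 / 2 + 2 := by gcongr
      _ = ((1 / 2 + 2 : ℝ≥0) : ℝ≥0∞) := by simp
  -- A coefficient above `t` would alone contribute at least `ρ(t|xₙ|) ≥ 1 > 1/2`.
  · have hb1 : ∀ n, t⁻¹ * b n ≤ 1 := by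
      intro n
      by_contra! h
      rw [← div_eq_inv_mul, one_lt_div ht] at h
      have h1 := (ENNReal.le_tsum n).trans hb
      have h2 := (ht1 (τ (τ' n))).trans (modular_mono hM (g := fun ω =>
        b n * ‖x (τ (τ' n)) ω‖₊) (.of_forall fun ω => by gcongr))
      have h3 := h2.trans h1
      simp at h3
    calc ∑' n, extendTop ψ (t⁻¹ * b n)
        ≤ ∑' n, extendTop (φ (τ (τ' n))) (t⁻¹ * b n) + 2 :=
          tsum_extendTop_le_add (fun n => by rw [dist_comm]; exact hdist n) _
      _ ≤ (m⁻¹ : ℝ≥0) * coeffModular (expMO P) μ (x ∘ τ ∘ τ') b + 2 := by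
          rw [coeffModular, ← ENNReal.tsum_mul_left]
          gcongr with n
          have hle := (hφ (τ (τ' n)) _ (hb1 n)).2.trans (modular_mono hM
            (g := fun ω => b n * ‖x (τ (τ' n)) ω‖₊) (.of_forall fun ω => ?_))
          · rw [ENNReal.coe_inv hm.ne', ← ENNReal.div_eq_inv_mul]
            rw [ENNReal.le_div_iff_mul_le (by simp [hm.ne']) (by simp), mul_comm]
            exact hle
          · calc t⁻¹ * b n * (s * ‖x (τ (τ' n)) ω‖₊ / 2)
                = (t⁻¹ * s) * (b n * ‖x (τ (τ' n)) ω‖₊ / 2) := by ring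
              _ ≤ 1 * (b n * ‖x (τ (τ' n)) ω‖₊) := by
                  gcongr
                  · rw [← div_eq_inv_mul]
                    exact (div_le_one ht).2 hst
                  · exact half_le_self (zero_le)
              _ = b n * ‖x (τ (τ' n)) ω‖₊ := one_mul _
      _ ≤ (m⁻¹ : ℝ≥0) * (1 / 2) + 2 := by gcongr
      _ = ((m⁻¹ * (1 / 2) + 2 : ℝ≥0) : ℝ≥0∞) := by simp

end Exponent

end VarLeb

end

theorem mainTheorem7 {𝕜 : Type*} [RCLike 𝕜] {Ω : Type*} [MeasurableSpace Ω]
    (μ : MeasureTheory.Measure Ω) [MeasureTheory.SigmaFinite μ]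
    (P : Ω → ℝ≥0∞) (hPm : Measurable P) (hP : ∀ ω, 0 < P ω)
    (hPmin : 0 < sInf (VarLeb.essRange P μ))
    (x : ℕ → Ω → 𝕜)
    (hdisj : VarLeb.DisjointlySupported μ x)
    (hnorm : VarLeb.SemiNormalized (VarLeb.expMO P) μ x) :
    ∃ σ : ℕ → ℕ, StrictMono σ ∧
      ∃ F ∈ VarLeb.orliczClass (VarLeb.essRange P μ),
        ∃ h : VarLeb.coeffSpace (VarLeb.expMO P) μ (x ∘ σ) = VarLeb.orliczSeqSpace 𝕜 F,
          VarLeb.coeffTopology (VarLeb.expMO P) μ (x ∘ σ) =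
            (VarLeb.orliczSeqTopology 𝕜 F).induced (Set.inclusion h.subset) := by
  -- A finite `r` is picked below the infimum, which may itself be `∞`.
  obtain ⟨r, hr, hrP⟩ : ∃ r : ℝ, 0 < r ∧ ENNReal.ofReal r ≤ sInf (VarLeb.essRange P μ) := by
    obtain ⟨r, hr0, hr⟩ := ENNReal.lt_iff_exists_nnreal_btwn.1 hPmin
    exact ⟨r, by exact_mod_cast hr0, by rw [ENNReal.ofReal_coe_nnreal]; exact hr.le⟩
  have hR : ∀ p ∈ VarLeb.essRange P μ, ENNReal.ofReal r ≤ p := fun p hp =>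
    hrP.trans (sInf_le hp)
  obtain ⟨σ, hσ, φ, hφ, hBA, hAB⟩ := VarLeb.exists_extendTop_dominates hPm hP hr hR hnorm
  have hM := VarLeb.isMusielak_expMO hPm hP
  have hy : VarLeb.DisjointlySupported μ (x ∘ σ) := fun m n hmn => hdisj (hσ.injective.ne hmn)
  have hm : ∀ n, AEStronglyMeasurable ((x ∘ σ) n) μ := fun n => (hnorm.1 (σ n)).1
  have hφc := VarLeb.hullK_subset_indexCone hr hR hφ
  have hA := VarLeb.lowerIndex_coeffModular hPm hR (x ∘ σ)
  have hB := VarLeb.lowerIndex_extendTop hφc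
  have h := VarLeb.coeffSpace_eq_orliczSeqSpace hM hr hy hm hA hB hBA hAB
  exact ⟨σ, hσ, VarLeb.extendTop φ, VarLeb.extendTop_mem_orliczClass hr hR hφ, h,
    VarLeb.coeffTopology_eq_induced hM (VarLeb.isMusielak_extendTop hr hφc) hr hy hm hA hB hBA
      hAB h⟩
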